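/- For $n\ge 1$ let $\mathcal K_n$ be the set of polynomials $P(z)=\sum_{k=0}^n a_k z^k$ with $a_k\in\mathbb C$, $|a_k|=1$, and for such $P$ let $P^*(z)=\sum_{k=0}^n \overline{a_{n-k}}\,z^k$. Let $0<n_1<n_2<\cdots$ be integers (for instance $n_j=j$) and let $P_{n_j}(z)=\sum_{k=0}^{n_j}a_{k,n_j}z^k\in\mathcal K_{n_j}$ be an ultraflat sequence, that is, there are $\varepsilon_{n_j}>0$ with $\varepsilon_{n_j}\to0$ such that $$(1-\varepsilon_{n_j})\sqrt{n_j+1}\le |P_{n_j}(e^{it})|\le(1+\varepsilon_{n_j})\sqrt{n_j+1}\qquad\text{for all } t\in\mathbb R \text{ and all } j .$$ Then, for every $n=n_j$, $$\sum_{k=0}^{n}k^2\left|a_{k,n}-\overline{a_{n-k,n}}\right|^2=\frac1{2\pi}\int_0^{2\pi}\left|(P_n'-P_n^{*\prime})(e^{it})\right|^2dt,$$ and the ratio of this quantity to $\dfrac{2n^3}{3}$ tends to $1$ as $n=n_j\to\infty$. -/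

import Mathlib

noncomputable section

/-- The class `K_n` of unimodular polynomials `∑_{k=0}^n a_k z^k`, with `a_k ∈ ℂ`, `|a_k| = 1`. -/
def unimodularClass (n : ℕ) : Set (Polynomial ℂ) :=
  {p | ∃ a : ℕ → ℂ, (∀ k ≤ n, ‖a k‖ = 1) ∧
    p = ∑ k ∈ Finset.range (n + 1), Polynomial.C (a k) * Polynomial.X ^ k}

/-- The conjugate (reciprocal) polynomial `Q^*(z) = ∑_{k=0}^n conj(a_{n-k}) z^k` of
`Q(z) = ∑_{k=0}^n a_k z^k`, formed with respect to the degree `n`. -/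
def conjReciprocal (n : ℕ) (Q : Polynomial ℂ) : Polynomial ℂ :=
  ∑ k ∈ Finset.range (n + 1),
    Polynomial.C (starRingEnd ℂ (Q.coeff (n - k))) * Polynomial.X ^ k

/-- A polynomial `P ∈ K_n` is `ε`-flat if
`(1 - ε) √(n+1) ≤ |P(e^{it})| ≤ (1 + ε) √(n+1)` for all real `t`. -/
def IsFlat (ε : ℝ) (n : ℕ) (P : Polynomial ℂ) : Prop :=
  P ∈ unimodularClass n ∧ ∀ t : ℝ,
    (1 - ε) * Real.sqrt (n + 1) ≤ ‖P.eval (Complex.exp (t * Complex.I))‖ ∧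
    ‖P.eval (Complex.exp (t * Complex.I))‖ ≤ (1 + ε) * Real.sqrt (n + 1)

/-- `P 0, P 1, …` with `P j ∈ K_{ν j}`, for an increasing sequence `ν 0 < ν 1 < …` of positive
integers, is ultraflat if each `P j` is `ε j`-flat for some positive `ε j` tending to `0`.
The full sequence of degrees `1, 2, 3, …` is the case `ν j = j + 1`. -/
def IsUltraflat (ν : ℕ → ℕ) (P : ℕ → Polynomial ℂ) : Prop :=
  StrictMono ν ∧ (∀ j, 0 < ν j) ∧
  ∃ ε : ℕ → ℝ, (∀ j, 0 < ε j) ∧ Filter.Tendsto ε Filter.atTop (nhds 0) ∧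
    ∀ j, IsFlat (ε j) (ν j) (P j)

end

/-! Write b_k = a_k a_{n-k}, S = ∑ b_k and T = ∑ k² b_k. Parseval gives the integral identity, and
since |a_k| = 1, expanding the squares gives n(n+1)(2n+1)/3 - 2 Re T (`sum_sq_norm_coeff_sub_eq`).
It remains to show T = o(n³).

Flatness makes P P* close to (n+1) zⁿ on the circle, and the maximum principle carries this to an
annulus of width about Y/n, where Y may grow as ε → 0. So P has no zeros there
(`eval_ne_zero_of_nearly_flat`), and Borel–Carathéodory with Cauchy's estimate bounds the second
derivative of log P along the circle by O(n²/Y) = o(n²) (`norm_euler_euler_mul_sub_sq_le`).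

This is used twice, with D = z d/dz. The n-th coefficient of (D²P)P - (DP)² is 2T - n²S/2, and the
polynomial is o(n³) on the circle, so S = o(n) suffices. For |h| = O(1/n), P(e^{ih}z) P(e^{-ih}z)
differs from P(z)² by o(n); taking n-th coefficients, the discrete Fourier transform of b has nearly
the same modulus at each of the first q² frequencies as S, its value at frequency 0. Its total
energy is (n+1)², so |S| ≤ (n+1)/q + o(n) for every fixed q (`norm_sum_coeff_mul_coeff_le`). -/

/-! ### Second derivative of a logarithm on a zero-free disc -/

/-- If `F` is zero-free on a disc and bounded there by `exp A * ‖F 0‖`, then the second derivative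
of `log F` at the centre is at most `16 A / R ^ 2`. -/
theorem norm_mul_sub_sq_le_of_ne_zero_on_ball {F F₁ F₂ : ℂ → ℂ} {R A : ℝ}
    (hF : ∀ z, HasDerivAt F (F₁ z) z) (hF₁ : ∀ z, HasDerivAt F₁ (F₂ z) z)
    (hR : 0 < R) (hA : 0 < A) (hne : ∀ z ∈ Metric.ball (0 : ℂ) R, F z ≠ 0)
    (hb : ∀ z ∈ Metric.ball (0 : ℂ) R, ‖F z‖ ≤ Real.exp A * ‖F 0‖) :
    ‖F₂ 0 * F 0 - F₁ 0 ^ 2‖ ≤ 16 * A / R ^ 2 * ‖F 0‖ ^ 2 := by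
  have h0 : (0 : ℂ) ∈ Metric.ball (0 : ℂ) R := Metric.mem_ball_self hR
  have hdF : Differentiable ℂ F := fun z => (hF z).differentiableAt
  have hdF₁ : Differentiable ℂ F₁ := fun z => (hF₁ z).differentiableAt
  have hq : DifferentiableOn ℂ (fun z => F₁ z / F z) (Metric.ball 0 R) :=
    hdF₁.differentiableOn.div hdF.differentiableOn hne
  -- `L` is the branch of log (F / F 0) vanishing at 0.
  obtain ⟨L, hL0, hL⟩ := hq.isExactOn_ball.with_val_at 0 0
  have hLd : DifferentiableOn ℂ L (Metric.ball 0 R) :=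
    fun z hz => (hL z hz).differentiableAt.differentiableWithinAt
  have hconst : ∀ z ∈ Metric.ball (0 : ℂ) R, F z = F 0 * Complex.exp (L z) := by
    have hder : ∀ z ∈ Metric.ball (0 : ℂ) R,
        HasDerivAt (fun z => F z * Complex.exp (-L z)) 0 z := by
      intro z hz
      have h := (hF z).mul ((hL z hz).neg.cexp)
      refine h.congr_deriv ?_
      linear_combination -Complex.exp (-L z) * mul_div_cancel₀ (F₁ z) (hne z hz)
    intro z hz
    have h := (convex_ball (0 : ℂ) R).is_const_of_fderivWithin_eq_zero (𝕜 := ℂ)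
      (f := fun z => F z * Complex.exp (-L z))
      (fun w hw => (hder w hw).differentiableAt.differentiableWithinAt)
      (fun w hw => by
        rw [fderivWithin_of_isOpen Metric.isOpen_ball hw]
        ext
        simpa using (hder w hw).deriv) hz h0
    simp only [hL0, neg_zero, Complex.exp_zero, mul_one] at h
    rw [← h, mul_assoc, ← Complex.exp_add]
    simp
  have hF0 : 0 < ‖F 0‖ := norm_pos_iff.2 (hne 0 h0)
  have hre : Set.MapsTo L (Metric.ball 0 R) {z | z.re ≤ A} := by
    intro z hz
    have h := hb z hz
    rw [hconst z hz, norm_mul, Complex.norm_exp, mul_comm] at h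
    exact Real.exp_le_exp.1 (le_of_mul_le_mul_right h hF0)
  -- Borel–Carathéodory at radius r = R/2 gives 2Ar/(R - r) = 2A; Cauchy's estimate on that circle
  -- then gives 2! · 2A / (R/2)² = 16A/R².
  have hbd : ∀ z ∈ Metric.sphere (0 : ℂ) (R / 2), ‖L z‖ ≤ 2 * A := by
    intro z hz
    have hz' : ‖z‖ = R / 2 := by simpa using hz
    have h := Complex.borelCaratheodory_zero hA hLd hre hR
      (z := z) (by simp [hz', hR]) hL0
    rw [hz'] at h
    refine h.trans (le_of_eq ?_)
    field_simp
    ring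
  have hC := Complex.norm_iteratedDeriv_le_of_forall_mem_sphere_norm_le 2 (half_pos hR)
    (f := L) (c := 0) (C := 2 * A)
    (hLd.diffContOnCl_ball (Metric.closedBall_subset_ball (half_lt_self hR))) hbd
  have hd2 : iteratedDeriv 2 L 0 = (F₂ 0 * F 0 - F₁ 0 ^ 2) / F 0 ^ 2 := by
    rw [iteratedDeriv_succ, iteratedDeriv_one]
    have he : deriv L =ᶠ[nhds 0] fun z => F₁ z / F z := by
      filter_upwards [Metric.isOpen_ball.mem_nhds h0] with z hz using (hL z hz).deriv
    have h := ((hF₁ 0).div (hF 0) (hne 0 h0)).deriv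
    rw [he.deriv_eq]
    exact h.trans (by ring)
  rw [hd2, norm_div, norm_pow, div_le_iff₀ (by positivity)] at hC
  refine hC.trans (le_of_eq ?_)
  congr 1
  simp [Nat.factorial]
  field_simp
  norm_num

/-! ### Bounds and Parseval from values on the unit circle -/

namespace Polynomial

theorem norm_eval_le_of_norm_le_one {Q : ℂ[X]} {M : ℝ}
    (hQ : ∀ z : ℂ, ‖z‖ = 1 → ‖Q.eval z‖ ≤ M) {z : ℂ} (hz : ‖z‖ ≤ 1) : ‖Q.eval z‖ ≤ M := by
  refine Complex.norm_le_of_forall_mem_frontier_norm_le (f := fun z => Q.eval z)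
    (U := Metric.ball 0 1) Metric.isBounded_ball Q.differentiable.diffContOnCl ?_ ?_
  · intro w hw
    rw [frontier_ball _ one_ne_zero] at hw
    exact hQ w (by simpa using hw)
  · rw [closure_ball _ one_ne_zero]
    simpa using hz

/-- The maximum principle in the unit disc, applied to the reversed polynomial. -/
theorem norm_eval_le_of_one_le_norm {Q : ℂ[X]} {M : ℝ} {N : ℕ} (hN : Q.natDegree ≤ N)
    (hQ : ∀ z : ℂ, ‖z‖ = 1 → ‖Q.eval z‖ ≤ M) {z : ℂ} (hz : 1 ≤ ‖z‖) :
    ‖Q.eval z‖ ≤ M * ‖z‖ ^ N := by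
  have key : ∀ w : ℂ, w ≠ 0 → Q.eval w = (Q.reflect N).eval w⁻¹ * w ^ N := by
    intro w hw
    let _ : Invertible w := invertibleOfNonzero hw
    have h := eval₂_reflect_mul_pow (RingHom.id ℂ) w N Q hN
    simpa [eval₂_id] using h.symm
  have hz0 : z ≠ 0 := norm_pos_iff.1 (zero_lt_one.trans_le hz)
  have h1 : ∀ w : ℂ, ‖w‖ = 1 → ‖(Q.reflect N).eval w‖ ≤ M := by
    intro w hw
    have hw0 : w⁻¹ ≠ 0 := inv_ne_zero (norm_pos_iff.1 (by rw [hw]; exact zero_lt_one))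
    have h := hQ w⁻¹ (by simp [hw])
    rw [key _ hw0] at h
    simpa [hw] using h
  rw [key z hz0, norm_mul, norm_pow]
  gcongr
  exact norm_eval_le_of_norm_le_one h1 (by rw [norm_inv]; exact inv_le_one_of_one_le₀ hz)

/-- A coefficient is at most the maximum modulus on the unit circle. -/
theorem norm_coeff_le_of_forall_norm_eval_le {Q : ℂ[X]} {M : ℝ}
    (hQ : ∀ z : ℂ, ‖z‖ = 1 → ‖Q.eval z‖ ≤ M) (n : ℕ) : ‖Q.coeff n‖ ≤ M := by
  have hM : 0 ≤ M := (norm_nonneg _).trans (hQ 1 (by simp))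
  have h1 : ‖Q.coeff n‖ ^ 2 ≤ ∑ i ∈ Q.support, ‖Q.coeff i‖ ^ 2 := by
    by_cases hn : n ∈ Q.support
    · exact Finset.single_le_sum (f := fun i => ‖Q.coeff i‖ ^ 2) (fun _ _ => by positivity) hn
    · rw [notMem_support_iff.1 hn]
      simpa using Finset.sum_nonneg (fun i _ => by positivity)
  rw [sum_sq_norm_coeff_eq_circleAverage] at h1
  have h2 : Real.circleAverage (fun θ ↦ ‖Q.eval θ‖ ^ 2) 0 1 ≤ M ^ 2 := by
    refine Real.circleAverage_mono_on_of_le_circle ?_ ?_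
    · refine ContinuousOn.circleIntegrable' (Continuous.continuousOn ?_)
      fun_prop
    · intro x hx
      have := hQ x (by simpa using hx)
      gcongr
  exact abs_le_of_sq_le_sq' (h1.trans h2) hM |>.2

/-- Parseval's identity with an explicit integral over `[0, 2π]`. -/
theorem sum_range_sq_norm_coeff_eq_integral (Q : ℂ[X]) {n : ℕ} (hn : Q.natDegree < n) :
    ∑ k ∈ Finset.range n, ‖Q.coeff k‖ ^ 2 = 1 / (2 * Real.pi) *
      ∫ t in (0 : ℝ)..(2 * Real.pi), ‖Q.eval (Complex.exp (t * Complex.I))‖ ^ 2 := by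
  have h := Q.sum_sq_norm_coeff_eq_circleAverage
  rw [Real.circleAverage_def] at h
  rw [one_div, ← smul_eq_mul]
  convert h using 1
  · symm
    refine Finset.sum_subset (fun k hk => ?_) (fun k _ hk => ?_)
    · exact Finset.mem_range.2 ((le_natDegree_of_mem_supp k hk).trans_lt hn)
    · rw [notMem_support_iff.1 hk]; simp
  · simp [circleMap]

end Polynomial

/-! ### The Euler operator -/

namespace Polynomial

/-- The Euler operator `z d/dz` on polynomials. -/
noncomputable def euler (P : ℂ[X]) : ℂ[X] := X * derivative P

theorem coeff_euler (P : ℂ[X]) (k : ℕ) : P.euler.coeff k = k * P.coeff k := by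
  cases k with
  | zero => simp [euler]
  | succ k => rw [euler, coeff_X_mul, coeff_derivative]; push_cast; ring

theorem natDegree_euler_le (P : ℂ[X]) {n : ℕ} (hP : P.natDegree ≤ n) : P.euler.natDegree ≤ n := by
  refine natDegree_le_iff_coeff_eq_zero.2 fun k hk => ?_
  rw [coeff_euler, coeff_eq_zero_of_natDegree_lt (hP.trans_lt hk), mul_zero]

/-- In the logarithmic variable, differentiation becomes the Euler operator, which multiplies the
k-th coefficient by k and does not raise the degree. -/
theorem hasDerivAt_eval_exp (P : ℂ[X]) (c w : ℂ) :
    HasDerivAt (fun w => P.eval (Complex.exp (c + w))) (P.euler.eval (Complex.exp (c + w))) w := by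
  have h := (P.hasDerivAt (Complex.exp (c + w))).comp w ((hasDerivAt_id' w).const_add c).cexp
  exact h.congr_deriv (by simp [euler, mul_comm])

theorem hasDerivAt_eval_exp_mul_I (P : ℂ[X]) (t : ℝ) :
    HasDerivAt (fun t : ℝ => P.eval (Complex.exp (t * Complex.I)))
      (Complex.I * P.euler.eval (Complex.exp (t * Complex.I))) t := by
  have h := (P.hasDerivAt_eval_exp 0 (t * Complex.I)).comp t
    ((hasDerivAt_id' t).ofReal_comp.mul_const Complex.I)
  simp only [zero_add, Function.comp_def] at h
  exact h.congr_deriv (by simp [mul_comm])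

/-- Coefficient formula for a product, in a form suited to degree `n` palindromes. -/
theorem coeff_mul_eq_sum_range (P Q : ℂ[X]) (n : ℕ) :
    (P * Q).coeff n = ∑ k ∈ Finset.range (n + 1), P.coeff k * Q.coeff (n - k) := by
  rw [coeff_mul, Finset.Nat.sum_antidiagonal_eq_sum_range_succ_mk]

end Polynomial

open Polynomial

/-! ### The conjugate reciprocal polynomial -/

theorem coeff_conjReciprocal (n : ℕ) (Q : ℂ[X]) {k : ℕ} (hk : k ≤ n) :
    (conjReciprocal n Q).coeff k = starRingEnd ℂ (Q.coeff (n - k)) := by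
  simp only [conjReciprocal, finsetSum_coeff, coeff_C_mul, coeff_X_pow]
  rw [Finset.sum_eq_single_of_mem k (Finset.mem_range.2 (by omega))]
  · simp
  · intro b _ hb
    simp [hb.symm]

theorem natDegree_conjReciprocal_le (n : ℕ) (Q : ℂ[X]) : (conjReciprocal n Q).natDegree ≤ n := by
  refine natDegree_sum_le_of_forall_le _ _ fun k hk => ?_
  exact (natDegree_C_mul_X_pow_le _ _).trans (by have := Finset.mem_range.1 hk; omega)

theorem eval_conjReciprocal {n : ℕ} {Q : ℂ[X]} (hQ : Q.natDegree ≤ n) {z : ℂ} (hz : ‖z‖ = 1) :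
    (conjReciprocal n Q).eval z = z ^ n * starRingEnd ℂ (Q.eval z) := by
  rw [eval_eq_sum_range' (Nat.lt_succ_of_le hQ), map_sum, Finset.mul_sum,
    ← Finset.sum_range_reflect, conjReciprocal, eval_finsetSum]
  refine Finset.sum_congr rfl fun k hk => ?_
  have hk' : k ≤ n := by have := Finset.mem_range.1 hk; omega
  have hzz : z * starRingEnd ℂ z = 1 := by rw [Complex.mul_conj']; simp [hz]
  have h : z ^ n * starRingEnd ℂ z ^ (n - k) = z ^ k := by
    rw [← Nat.add_sub_of_le hk', pow_add, Nat.add_sub_cancel_left, mul_assoc, ← mul_pow, hzz]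
    simp
  simp only [Nat.succ_eq_add_one, Nat.add_sub_cancel, eval_mul, eval_C, eval_pow, eval_X, map_mul,
    map_pow]
  rw [← h]
  ring

/-! ### Zero-free annulus and logarithmic derivatives of flat polynomials -/

/-- A nearly flat polynomial of degree `n` has no zeros in an annulus of width about `1 / n`
around the unit circle. -/
theorem eval_ne_zero_of_nearly_flat {n : ℕ} {P : ℂ[X]} (hP : P.natDegree ≤ n) {s ε Y : ℝ}
    (hs : 0 < s) (hε : 0 < ε) (hε1 : ε ≤ 1) (hY : 3 * ε * Real.exp Y < 1)
    (hlo : ∀ z : ℂ, ‖z‖ = 1 → (1 - ε) * s ≤ ‖P.eval z‖)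
    (hhi : ∀ z : ℂ, ‖z‖ = 1 → ‖P.eval z‖ ≤ (1 + ε) * s)
    {w : ℂ} (hw : n * |w.re| ≤ Y) : P.eval (Complex.exp w) ≠ 0 := by
  intro h0
  -- On the circle `E` equals zⁿ(|P|² - s²), of modulus at most 3εs². At a zero of P only the term
  -- s² zⁿ survives, which is too large for the growth of `E`.
  set E : ℂ[X] := P * conjReciprocal n P - C ((s : ℂ) ^ 2) * X ^ n with hE
  have hEdeg : E.natDegree ≤ n + n := by
    refine (natDegree_sub_le _ _).trans (max_le
      (natDegree_mul_le_of_le hP (natDegree_conjReciprocal_le n P)) ?_)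
    exact (natDegree_C_mul_X_pow_le _ _).trans (by omega)
  have hEb : ∀ z : ℂ, ‖z‖ = 1 → ‖E.eval z‖ ≤ 3 * ε * s ^ 2 := by
    intro z hz
    have h : E.eval z = z ^ n * ((‖P.eval z‖ ^ 2 - s ^ 2 : ℝ) : ℂ) := by
      simp only [hE, eval_sub, eval_mul, eval_conjReciprocal hP hz, eval_C, eval_pow, eval_X]
      push_cast
      rw [← Complex.mul_conj']
      ring
    rw [h, norm_mul, norm_pow, hz, one_pow, one_mul, Complex.norm_real, Real.norm_eq_abs, abs_le]
    have h1 := hlo z hz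
    have h2 := hhi z hz
    have h3 : ((1 - ε) * s) ^ 2 ≤ ‖P.eval z‖ ^ 2 :=
      pow_le_pow_left₀ (mul_nonneg (by linarith) hs.le) h1 2
    have h4 : ‖P.eval z‖ ^ 2 ≤ ((1 + ε) * s) ^ 2 := pow_le_pow_left₀ (norm_nonneg _) h2 2
    have h5 : 0 ≤ ε * s ^ 2 := by positivity
    have h6 : 0 ≤ ε * s ^ 2 * (1 - ε) := mul_nonneg h5 (by linarith)
    constructor <;> nlinarith
  have hEw : ‖E.eval (Complex.exp w)‖ = s ^ 2 * Real.exp (n * w.re) := by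
    simp [hE, h0, Complex.norm_exp, Real.exp_nat_mul]
  have hs2 : 0 < s ^ 2 := by positivity
  -- Outside the disc, degree 2n allows growth e^{2n Re w} against the actual e^{n Re w}; inside,
  -- the bound 3εs² meets s² e^{-n|Re w|}.
  have hcontra : 1 ≤ 3 * ε * Real.exp (n * |w.re|) := by
    rcases le_total 0 w.re with hw0 | hw0
    · have h := norm_eval_le_of_one_le_norm hEdeg hEb (z := Complex.exp w)
        (by rw [Complex.norm_exp]; exact Real.one_le_exp hw0)
      rw [hEw, Complex.norm_exp, pow_add, ← Real.exp_nat_mul] at h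
      rw [abs_of_nonneg hw0]
      have hp := Real.exp_pos (n * w.re)
      have : (s ^ 2 * Real.exp (n * w.re)) * 1 ≤
          (s ^ 2 * Real.exp (n * w.re)) * (3 * ε * Real.exp (n * w.re)) := by linarith
      exact le_of_mul_le_mul_left this (by positivity)
    · have h := norm_eval_le_of_norm_le_one hEb (z := Complex.exp w)
        (by rw [Complex.norm_exp]; exact Real.exp_le_one_iff.2 hw0)
      rw [hEw] at h
      rw [abs_of_nonpos hw0]
      have hp := Real.exp_pos (n * -w.re)
      have h1 : Real.exp (n * w.re) ≤ 3 * ε :=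
        le_of_mul_le_mul_left (by linarith) hs2
      calc 1 = Real.exp (n * w.re) * Real.exp (n * -w.re) := by
            rw [← Real.exp_add]; simp
        _ ≤ _ := by gcongr
  have : Real.exp (n * |w.re|) ≤ Real.exp Y := Real.exp_le_exp.2 hw
  nlinarith

/-- For a nearly flat polynomial `P` of degree `n`, the second logarithmic derivative along the
unit circle is small compared with `n ^ 2`. -/
theorem norm_euler_euler_mul_sub_sq_le {n : ℕ} (hn : 0 < n) {P : ℂ[X]} (hP : P.natDegree ≤ n)
    {s ε Y : ℝ} (hs : 0 < s) (hε : 0 < ε) (hε1 : ε ≤ 1 / 2) (hY0 : 0 < Y)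
    (hY : 3 * ε * Real.exp Y < 1)
    (hlo : ∀ z : ℂ, ‖z‖ = 1 → (1 - ε) * s ≤ ‖P.eval z‖)
    (hhi : ∀ z : ℂ, ‖z‖ = 1 → ‖P.eval z‖ ≤ (1 + ε) * s) (t : ℝ) :
    ‖P.euler.euler.eval (Complex.exp (t * Complex.I)) * P.eval (Complex.exp (t * Complex.I))
      - P.euler.eval (Complex.exp (t * Complex.I)) ^ 2‖ ≤
      16 * (Y + 2) / Y ^ 2 * n ^ 2 * ‖P.eval (Complex.exp (t * Complex.I))‖ ^ 2 := by
  have hn' : (0 : ℝ) < n := by exact_mod_cast hn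
  have hre : ∀ w ∈ Metric.ball (0 : ℂ) (Y / n), n * |(t * Complex.I + w).re| ≤ Y := by
    intro w hw
    have h1 : ‖w‖ < Y / n := by simpa using hw
    have h2 : |(t * Complex.I + w).re| ≤ ‖w‖ := by simpa using Complex.abs_re_le_norm w
    rw [lt_div_iff₀ hn'] at h1
    nlinarith
  -- Over the disc of radius Y/n, growth costs at most e^Y; the extra 2 in `A` absorbs (1 + ε)/(1 -
  -- ε) ≤ 3 ≤ e².
  have h := norm_mul_sub_sq_le_of_ne_zero_on_ball
    (F := fun w => P.eval (Complex.exp (t * Complex.I + w)))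
    (F₁ := fun w => P.euler.eval (Complex.exp (t * Complex.I + w)))
    (F₂ := fun w => P.euler.euler.eval (Complex.exp (t * Complex.I + w)))
    (R := Y / n) (A := Y + 2) (P.hasDerivAt_eval_exp _) (P.euler.hasDerivAt_eval_exp _)
    (by positivity) (by positivity)
    (fun w hw => eval_ne_zero_of_nearly_flat hP hs hε (by linarith) hY hlo hhi (hre w hw)) ?_
  · simp only [add_zero] at h
    refine h.trans (le_of_eq ?_)
    field_simp
  · intro w hw
    have h0 : ‖Complex.exp (t * Complex.I)‖ = 1 := Complex.norm_exp_ofReal_mul_I t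
    have h3 : (3 : ℝ) ≤ Real.exp 2 := by have := Real.add_one_le_exp 2; linarith
    have h4 : (1 + ε) * s ≤ Real.exp 2 * ‖P.eval (Complex.exp (t * Complex.I))‖ := by
      have h5 := hlo _ h0
      have h6 : (1 + ε) * s ≤ 3 * ((1 - ε) * s) := by nlinarith
      nlinarith [norm_nonneg (P.eval (Complex.exp (t * Complex.I)))]
    have h5 : ‖P.eval (Complex.exp (t * Complex.I + w))‖ ≤ (1 + ε) * s * Real.exp Y := by
      have hre' := hre w hw
      set u := t * Complex.I + w
      rcases le_total 0 u.re with hw0 | hw0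
      · refine (norm_eval_le_of_one_le_norm hP hhi (z := Complex.exp u)
          (by rw [Complex.norm_exp]; exact Real.one_le_exp hw0)).trans ?_
        rw [Complex.norm_exp, ← Real.exp_nat_mul]
        rw [abs_of_nonneg hw0] at hre'
        gcongr
      · refine (norm_eval_le_of_norm_le_one hhi (z := Complex.exp u)
          (by rw [Complex.norm_exp]; exact Real.exp_le_one_iff.2 hw0)).trans ?_
        exact le_mul_of_one_le_right (by positivity) (Real.one_le_exp hY0.le)
    simp only [add_zero]
    calc _ ≤ (1 + ε) * s * Real.exp Y := h5
      _ ≤ Real.exp 2 * ‖P.eval (Complex.exp (t * Complex.I))‖ * Real.exp Y := by gcongr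
      _ = _ := by rw [Real.exp_add]; ring

/-! ### Near-orthogonality of P and its conjugate reciprocal -/

/-- If the second logarithmic derivative of `P` along the unit circle is at most `κ`, then the
symmetric product `P(ωz) P(ω⁻¹z)` stays close to `P(z) ^ 2`. -/
theorem norm_eval_mul_eval_sub_sq_le {P : ℂ[X]} {κ B : ℝ}
    (hne : ∀ t : ℝ, P.eval (Complex.exp (t * Complex.I)) ≠ 0)
    (hκ : ∀ t : ℝ,
      ‖P.euler.euler.eval (Complex.exp (t * Complex.I)) * P.eval (Complex.exp (t * Complex.I))
        - P.euler.eval (Complex.exp (t * Complex.I)) ^ 2‖ ≤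
        κ * ‖P.eval (Complex.exp (t * Complex.I))‖ ^ 2)
    (hB : ∀ t : ℝ, ‖P.eval (Complex.exp (t * Complex.I))‖ ≤ B) (t : ℝ) {h : ℝ} (hh : 0 ≤ h) :
    ‖P.eval (Complex.exp ((t + h : ℝ) * Complex.I)) * P.eval (Complex.exp ((t - h : ℝ) * Complex.I))
      - P.eval (Complex.exp (t * Complex.I)) ^ 2‖ ≤ 2 * κ * B ^ 2 * h ^ 2 := by
  set p : ℝ → ℂ := fun t => P.eval (Complex.exp (t * Complex.I)) with hp
  set d : ℝ → ℂ := fun t => P.euler.eval (Complex.exp (t * Complex.I)) with hd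
  set d₂ : ℝ → ℂ := fun t => P.euler.euler.eval (Complex.exp (t * Complex.I)) with hd₂
  have hpd : ∀ t, HasDerivAt p (Complex.I * d t) t := P.hasDerivAt_eval_exp_mul_I
  have hdd : ∀ t, HasDerivAt d (Complex.I * d₂ t) t := P.euler.hasDerivAt_eval_exp_mul_I
  have hlip : ∀ x y : ℝ, ‖d x / p x - d y / p y‖ ≤ κ * ‖x - y‖ := by
    intro x y
    refine Convex.norm_image_sub_le_of_norm_hasDerivWithin_le (s := Set.univ)
      (f := fun x => d x / p x) (f' := fun x => Complex.I * (d₂ x * p x - d x ^ 2) / p x ^ 2)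
      (fun u _ => ?_) (fun u _ => ?_) convex_univ (Set.mem_univ y) (Set.mem_univ x)
    · refine HasDerivAt.hasDerivWithinAt ?_
      exact ((hdd u).div (hpd u) (hne u)).congr_deriv (by ring)
    · rw [norm_div, norm_mul, Complex.norm_I, one_mul, norm_pow,
        div_le_iff₀ (pow_pos (norm_pos_iff.2 (hne u)) 2)]
      exact hκ u
  have hκ0 : 0 ≤ κ := by
    have := (norm_nonneg _).trans (hlip 1 0)
    simpa using this
  have hB0 : 0 ≤ B := (norm_nonneg _).trans (hB 0)
  -- The logarithmic derivative of the product is a difference of values of `d / p` at points 2x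
  -- apart, so `hlip` bounds it by 2κh on [0, h].
  have hder : ∀ x : ℝ, HasDerivAt (fun x => p (t + x) * p (t - x))
      (Complex.I * (p (t + x) * p (t - x)) * (d (t + x) / p (t + x) - d (t - x) / p (t - x))) x := by
    intro x
    have h1 := (hpd (t + x)).scomp x ((hasDerivAt_id' x).const_add t)
    have h2 := (hpd (t - x)).scomp x ((hasDerivAt_id' x).const_sub t)
    refine (h1.mul h2).congr_deriv ?_
    have e1 := hne (t + x)
    have e2 := hne (t - x)
    change p (t + x) ≠ 0 at e1
    change p (t - x) ≠ 0 at e2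
    simp only [Function.comp_apply, one_smul, neg_smul]
    field_simp
    ring
  have hmv := Convex.norm_image_sub_le_of_norm_hasDerivWithin_le (s := Set.Icc 0 h)
    (f := fun x => p (t + x) * p (t - x)) (C := B * B * (κ * (2 * h)))
    (fun x _ => (hder x).hasDerivWithinAt) (fun x hx => ?_) (convex_Icc 0 h)
    (Set.left_mem_Icc.2 hh) (Set.right_mem_Icc.2 hh)
  · simp only [add_zero, sub_zero, ← sq] at hmv
    refine hmv.trans (le_of_eq ?_)
    rw [Real.norm_of_nonneg hh]
    ring
  · rw [norm_mul, norm_mul, norm_mul, Complex.norm_I, one_mul]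
    have h1 := hB (t + x)
    have h2 := hB (t - x)
    have h3 := hlip (t + x) (t - x)
    have h4 : ‖t + x - (t - x)‖ ≤ 2 * h := by
      rw [show t + x - (t - x) = 2 * x by ring, Real.norm_of_nonneg (by linarith [hx.1])]
      linarith [hx.2]
    gcongr
    exact h3.trans (by gcongr)

/-- Parseval's identity for the discrete Fourier transform of length `N`. -/
theorem sum_norm_sq_sum_mul_pow {N : ℕ} {ζ : ℂ} (hζ : IsPrimitiveRoot ζ N) (hN : 0 < N)
    (b : ℕ → ℂ) :
    ∑ j ∈ Finset.range N, ‖∑ k ∈ Finset.range N, b k * ζ ^ (j * k)‖ ^ 2 =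
      N * ∑ k ∈ Finset.range N, ‖b k‖ ^ 2 := by
  have hnorm : ‖ζ‖ = 1 := Complex.norm_eq_one_of_pow_eq_one hζ.pow_eq_one hN.ne'
  have hconj : starRingEnd ℂ ζ = ζ⁻¹ := (Complex.inv_eq_conj hnorm).symm
  have hζ0 : ζ ≠ 0 := hζ.ne_zero hN.ne'
  have horth : ∀ k ∈ Finset.range N, ∀ l ∈ Finset.range N,
      ∑ j ∈ Finset.range N, (ζ ^ k * (ζ⁻¹) ^ l) ^ j = if k = l then (N : ℂ) else 0 := by
    intro k hk l hl
    split_ifs with hkl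
    · subst hkl
      rw [← mul_pow, mul_inv_cancel₀ hζ0]
      simp
    · have h1 : ζ ^ k * (ζ⁻¹) ^ l ≠ 1 := by
        intro h
        rw [inv_pow, mul_inv_eq_one₀ (pow_ne_zero _ hζ0)] at h
        exact hkl (hζ.pow_inj (Finset.mem_range.1 hk) (Finset.mem_range.1 hl) h)
      rw [geom_sum_eq h1, mul_pow, ← pow_mul, ← pow_mul, mul_comm k, mul_comm l, pow_mul, pow_mul,
        inv_pow, hζ.pow_eq_one]
      simp
  apply Complex.ofReal_injective
  push_cast
  calc ∑ j ∈ Finset.range N, (‖∑ k ∈ Finset.range N, b k * ζ ^ (j * k)‖ : ℂ) ^ 2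
      = ∑ j ∈ Finset.range N, ∑ k ∈ Finset.range N, ∑ l ∈ Finset.range N,
          b k * starRingEnd ℂ (b l) * (ζ ^ k * (ζ⁻¹) ^ l) ^ j := by
        refine Finset.sum_congr rfl fun j _ => ?_
        rw [← Complex.mul_conj', map_sum, Finset.sum_mul_sum]
        refine Finset.sum_congr rfl fun k _ => Finset.sum_congr rfl fun l _ => ?_
        rw [map_mul, map_pow, hconj, mul_pow, ← pow_mul, ← pow_mul, mul_comm k, mul_comm l]
        ring
    _ = ∑ k ∈ Finset.range N, ∑ l ∈ Finset.range N,
          b k * starRingEnd ℂ (b l) * ∑ j ∈ Finset.range N, (ζ ^ k * (ζ⁻¹) ^ l) ^ j := by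
        rw [Finset.sum_comm]
        refine Finset.sum_congr rfl fun k _ => ?_
        rw [Finset.sum_comm]
        simp only [Finset.mul_sum]
    _ = ∑ k ∈ Finset.range N, b k * starRingEnd ℂ (b k) * N := by
        refine Finset.sum_congr rfl fun k hk => ?_
        rw [Finset.sum_congr rfl fun l hl => by rw [horth k hk l hl]]
        simp [hk]
    _ = _ := by
        rw [Finset.mul_sum]
        refine Finset.sum_congr rfl fun k _ => ?_
        rw [Complex.mul_conj']
        ring

/-- If the second logarithmic derivative of a unimodular polynomial `P` along the unit circle is at
most `κ`, then `P` is nearly orthogonal to its conjugate reciprocal. -/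
theorem norm_sum_coeff_mul_coeff_le {n : ℕ} {P : ℂ[X]} {κ B : ℝ}
    (hP : ∀ k ≤ n, ‖P.coeff k‖ = 1)
    (hne : ∀ t : ℝ, P.eval (Complex.exp (t * Complex.I)) ≠ 0)
    (hκ : ∀ t : ℝ,
      ‖P.euler.euler.eval (Complex.exp (t * Complex.I)) * P.eval (Complex.exp (t * Complex.I))
        - P.euler.eval (Complex.exp (t * Complex.I)) ^ 2‖ ≤
        κ * ‖P.eval (Complex.exp (t * Complex.I))‖ ^ 2)
    (hB : ∀ t : ℝ, ‖P.eval (Complex.exp (t * Complex.I))‖ ≤ B) {q : ℕ} (hq : 0 < q)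
    (hqn : q ^ 2 ≤ n + 1) :
    ‖∑ k ∈ Finset.range (n + 1), P.coeff k * P.coeff (n - k)‖ ≤
      2 * κ * B ^ 2 * (Real.pi * q ^ 2 / (n + 1)) ^ 2 + (n + 1) / q := by
  set N : ℕ := n + 1 with hN
  have hN0 : 0 < N := Nat.succ_pos n
  have hNr : (0 : ℝ) < N := by exact_mod_cast hN0
  have hcast : (n : ℝ) + 1 = N := by rw [hN]; push_cast; rfl
  set b : ℕ → ℂ := fun k => P.coeff k * P.coeff (n - k) with hb
  set ζ : ℂ := Complex.exp (2 * Real.pi * Complex.I / N) with hζ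
  have hprim : IsPrimitiveRoot ζ N := Complex.isPrimitiveRoot_exp N hN0.ne'
  have hκ0 : 0 ≤ κ := by
    have h := (norm_nonneg _).trans (hκ 0)
    have h1 : 0 < ‖P.eval (Complex.exp ((0 : ℝ) * Complex.I))‖ ^ 2 :=
      pow_pos (norm_pos_iff.2 (hne 0)) 2
    exact nonneg_of_mul_nonneg_left h h1
  set δ : ℝ := 2 * κ * B ^ 2 * (Real.pi * q ^ 2 / N) ^ 2 with hδ
  have hshift : ∀ j < q ^ 2, ‖∑ k ∈ Finset.range N, b k‖ ≤
      ‖∑ k ∈ Finset.range N, b k * ζ ^ (j * k)‖ + δ := by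
    intro j hj
    -- The half angle: the n-th coefficient of P(ωz)P(ω⁻¹z) is ω⁻ⁿ ∑ b_k ω^{2k}, and ω² = ζ^j makes
    -- this a Fourier coefficient of `b`.
    set h : ℝ := Real.pi * j / N with hh
    have hh0 : 0 ≤ h := by positivity
    set ω : ℂ := Complex.exp (h * Complex.I) with hω
    have hω0 : ω ≠ 0 := Complex.exp_ne_zero _
    have hω1 : ‖ω‖ = 1 := Complex.norm_exp_ofReal_mul_I h
    have hωζ : ω ^ 2 = ζ ^ j := by
      rw [hω, hζ, ← Complex.exp_nat_mul, ← Complex.exp_nat_mul, hh]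
      congr 1
      push_cast
      ring
    have hle : 2 * κ * B ^ 2 * h ^ 2 ≤ δ := by
      have : (j : ℝ) ≤ q ^ 2 := by exact_mod_cast hj.le
      rw [hδ, hh]
      gcongr
    have hbound := norm_coeff_le_of_forall_norm_eval_le
      (Q := P.comp (C ω * X) * P.comp (C ω⁻¹ * X) - P * P) (M := δ) (fun z hz => ?_) n
    · rw [coeff_sub, coeff_mul_eq_sum_range, coeff_mul_eq_sum_range] at hbound
      have e1 : ∑ k ∈ Finset.range (n + 1), (P.comp (C ω * X)).coeff k *
          (P.comp (C ω⁻¹ * X)).coeff (n - k) =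
          ω⁻¹ ^ n * ∑ k ∈ Finset.range N, b k * ζ ^ (j * k) := by
        rw [Finset.mul_sum]
        refine Finset.sum_congr rfl fun k hk => ?_
        have hk' : k ≤ n := by have := Finset.mem_range.1 hk; omega
        have e2 : ω⁻¹ ^ (n - k) = ω⁻¹ ^ n * ω ^ k := by
          have : ω⁻¹ ^ n = ω⁻¹ ^ (n - k) * ω⁻¹ ^ k := by rw [← pow_add, Nat.sub_add_cancel hk']
          rw [this, mul_assoc, ← mul_pow, inv_mul_cancel₀ hω0, one_pow, mul_one]
        rw [comp_C_mul_X_coeff, comp_C_mul_X_coeff, e2, pow_mul, ← hωζ]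
        simp only [hb]
        ring
      rw [e1] at hbound
      have h3 := norm_sub_norm_le (∑ k ∈ Finset.range N, b k)
        (ω⁻¹ ^ n * ∑ k ∈ Finset.range N, b k * ζ ^ (j * k))
      rw [norm_sub_rev, norm_mul, norm_pow, norm_inv, hω1, inv_one, one_pow, one_mul] at h3
      linarith
    · obtain ⟨t, rfl⟩ := (Complex.norm_eq_one_iff z).1 hz
      refine (le_of_eq ?_).trans ((norm_eval_mul_eval_sub_sq_le hne hκ hB t hh0).trans hle)
      have e1 : ω * Complex.exp (t * Complex.I) = Complex.exp ((t + h : ℝ) * Complex.I) := by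
        rw [hω, ← Complex.exp_add]; congr 1; push_cast; ring
      have e2 : ω⁻¹ * Complex.exp (t * Complex.I) = Complex.exp ((t - h : ℝ) * Complex.I) := by
        rw [hω, ← Complex.exp_neg, ← Complex.exp_add]; congr 1; push_cast; ring
      simp only [eval_sub, eval_mul, eval_comp, eval_C, eval_X, e1, e2, sq]
  rw [hcast]
  -- Otherwise q² frequencies would each have modulus above N/q, hence energy above N² in total,
  -- contradicting Parseval.
  by_contra! hcon
  have hq' : (0 : ℝ) < q := by exact_mod_cast hq
  have hb1 : ∀ k ∈ Finset.range N, ‖b k‖ ^ 2 = 1 := by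
    intro k hk
    have hk' : k ≤ n := by have := Finset.mem_range.1 hk; omega
    simp [hb, hP k hk', hP (n - k) (Nat.sub_le n k)]
  have hpars := sum_norm_sq_sum_mul_pow hprim hN0 b
  rw [Finset.sum_congr rfl hb1] at hpars
  have hlower : ∑ j ∈ Finset.range (q ^ 2), ((N : ℝ) / q) ^ 2 <
      ∑ j ∈ Finset.range (q ^ 2), ‖∑ k ∈ Finset.range N, b k * ζ ^ (j * k)‖ ^ 2 := by
    refine Finset.sum_lt_sum_of_nonempty (by simp [hq.ne']) fun j hj => ?_
    have := hshift j (Finset.mem_range.1 hj)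
    exact pow_lt_pow_left₀ (by linarith) (by positivity) two_ne_zero
  have hupper : ∑ j ∈ Finset.range (q ^ 2), ‖∑ k ∈ Finset.range N, b k * ζ ^ (j * k)‖ ^ 2 ≤
      ∑ j ∈ Finset.range N, ‖∑ k ∈ Finset.range N, b k * ζ ^ (j * k)‖ ^ 2 :=
    Finset.sum_le_sum_of_subset_of_nonneg (Finset.range_subset_range.2 hqn)
      fun _ _ _ => by positivity
  have hval : ∑ j ∈ Finset.range (q ^ 2), ((N : ℝ) / q) ^ 2 = N * N := by
    simp only [Finset.sum_const, Finset.card_range, nsmul_eq_mul]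
    push_cast
    field_simp
  simp only [Finset.sum_const, Finset.card_range, nsmul_eq_mul, mul_one] at hpars
  linarith

/-! ### Moments of the sequence a_k a_{n-k} -/

/-- The first moment of the palindromic sequence `a_k a_{n-k}`. -/
theorem sum_mul_coeff_mul_coeff (P : ℂ[X]) (n : ℕ) :
    2 * ∑ k ∈ Finset.range (n + 1), (k : ℂ) * (P.coeff k * P.coeff (n - k)) =
      n * ∑ k ∈ Finset.range (n + 1), P.coeff k * P.coeff (n - k) := by
  have h := Finset.sum_range_reflect
    (fun k => (k : ℂ) * (P.coeff k * P.coeff (n - k))) (n + 1)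
  rw [two_mul]
  nth_rw 1 [← h]
  rw [← Finset.sum_add_distrib, Finset.mul_sum]
  refine Finset.sum_congr rfl fun k hk => ?_
  have hk' : k ≤ n := by have := Finset.mem_range.1 hk; omega
  rw [show n + 1 - 1 - k = n - k by omega, Nat.sub_sub_self hk', Nat.cast_sub hk']
  ring

/-- The second moment of the sequence `a_k a_{n-k}` for a unimodular polynomial with small second
logarithmic derivative along the unit circle. -/
theorem norm_sum_sq_mul_coeff_mul_coeff_le {n : ℕ} {P : ℂ[X]} {κ B : ℝ}
    (hκ : ∀ t : ℝ,
      ‖P.euler.euler.eval (Complex.exp (t * Complex.I)) * P.eval (Complex.exp (t * Complex.I))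
        - P.euler.eval (Complex.exp (t * Complex.I)) ^ 2‖ ≤
        κ * ‖P.eval (Complex.exp (t * Complex.I))‖ ^ 2) (hκ0 : 0 ≤ κ)
    (hB : ∀ t : ℝ, ‖P.eval (Complex.exp (t * Complex.I))‖ ≤ B) :
    ‖∑ k ∈ Finset.range (n + 1), (k : ℂ) ^ 2 * (P.coeff k * P.coeff (n - k))‖ ≤
      (κ * B ^ 2 + n ^ 2 / 2 *
        ‖∑ k ∈ Finset.range (n + 1), P.coeff k * P.coeff (n - k)‖) / 2 := by
  set S := ∑ k ∈ Finset.range (n + 1), P.coeff k * P.coeff (n - k)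
  set T := ∑ k ∈ Finset.range (n + 1), (k : ℂ) ^ 2 * (P.coeff k * P.coeff (n - k))
  have hbound := norm_coeff_le_of_forall_norm_eval_le
    (Q := P.euler.euler * P - P.euler * P.euler) (M := κ * B ^ 2) (fun z hz => ?_) n
  -- The second product contributes ∑ k(n - k) b_k = n · (nS/2) - T, by the symmetry of b under k ↦
  -- n - k.
  · have e1 : (P.euler.euler * P - P.euler * P.euler).coeff n = 2 * T - n ^ 2 / 2 * S := by
      rw [coeff_sub, coeff_mul_eq_sum_range, coeff_mul_eq_sum_range]
      have e2 : ∑ k ∈ Finset.range (n + 1), P.euler.coeff k * P.euler.coeff (n - k) =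
          n * (∑ k ∈ Finset.range (n + 1), (k : ℂ) * (P.coeff k * P.coeff (n - k))) - T := by
        rw [Finset.mul_sum, ← Finset.sum_sub_distrib]
        refine Finset.sum_congr rfl fun k hk => ?_
        have hk' : k ≤ n := by have := Finset.mem_range.1 hk; omega
        rw [coeff_euler, coeff_euler, Nat.cast_sub hk']
        ring
      have e3 : ∑ k ∈ Finset.range (n + 1), P.euler.euler.coeff k * P.coeff (n - k) = T := by
        refine Finset.sum_congr rfl fun k _ => ?_
        rw [coeff_euler, coeff_euler]
        ring
      rw [e2, e3]
      linear_combination (-(n : ℂ) / 2) * sum_mul_coeff_mul_coeff P n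
    rw [e1] at hbound
    have h1 : ‖2 * T‖ ≤ ‖2 * T - n ^ 2 / 2 * S‖ + ‖(n : ℂ) ^ 2 / 2 * S‖ :=
      norm_le_norm_sub_add _ _
    simp only [norm_mul, norm_div, norm_pow, Complex.norm_natCast, Complex.norm_ofNat] at h1
    linarith
  · obtain ⟨t, rfl⟩ := (Complex.norm_eq_one_iff z).1 hz
    rw [eval_sub, eval_mul, eval_mul, ← sq (eval _ P.euler)]
    exact (hκ t).trans (by gcongr; exact hB t)

theorem coeff_of_mem_unimodularClass {n : ℕ} {P : ℂ[X]} (hP : P ∈ unimodularClass n) :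
    P.natDegree ≤ n ∧ ∀ k ≤ n, ‖P.coeff k‖ = 1 := by
  obtain ⟨a, ha, rfl⟩ := hP
  refine ⟨natDegree_sum_le_of_forall_le _ _ fun k hk => ?_, fun k hk => ?_⟩
  · exact (natDegree_C_mul_X_pow_le _ _).trans (by have := Finset.mem_range.1 hk; omega)
  · simp only [finsetSum_coeff, coeff_C_mul, coeff_X_pow]
    rw [Finset.sum_eq_single_of_mem k (Finset.mem_range.2 (by omega))]
    · simp [ha k hk]
    · intro b _ hb
      simp [hb.symm]

/-- An `ε`-flat polynomial with `ε` small in terms of `Y` has a small second moment of the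
sequence `a_k a_{n-k}`. -/
theorem IsFlat.second_moment_le {n q : ℕ} {P : ℂ[X]} {ε Y : ℝ}
    (h : IsFlat ε n P) (hn : 0 < n) (hε : 0 < ε) (hε1 : ε ≤ 1 / 2) (hY0 : 0 < Y)
    (hY : 3 * ε * Real.exp Y < 1) (hq : 0 < q) (hqn : q ^ 2 ≤ n + 1) :
    ‖∑ k ∈ Finset.range (n + 1), (k : ℂ) ^ 2 * (P.coeff k * P.coeff (n - k))‖ ≤
      (28 * (16 * (Y + 2) / Y ^ 2) * q ^ 4 + 2 / q) * n ^ 3 := by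
  obtain ⟨hdeg, hco⟩ := coeff_of_mem_unimodularClass h.1
  set s : ℝ := Real.sqrt (n + 1) with hs
  have hs0 : 0 < s := Real.sqrt_pos.2 (by positivity)
  have hs2 : s ^ 2 = n + 1 := Real.sq_sqrt (by positivity)
  have hlo : ∀ z : ℂ, ‖z‖ = 1 → (1 - ε) * s ≤ ‖P.eval z‖ := by
    intro z hz
    obtain ⟨t, rfl⟩ := (Complex.norm_eq_one_iff z).1 hz
    exact (h.2 t).1
  have hhi : ∀ z : ℂ, ‖z‖ = 1 → ‖P.eval z‖ ≤ (1 + ε) * s := by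
    intro z hz
    obtain ⟨t, rfl⟩ := (Complex.norm_eq_one_iff z).1 hz
    exact (h.2 t).2
  set κ : ℝ := 16 * (Y + 2) / Y ^ 2 with hκdef
  have hκ0 : 0 < κ := by positivity
  have hκ := norm_euler_euler_mul_sub_sq_le hn hdeg hs0 hε hε1 hY0 hY hlo hhi
  rw [← hκdef] at hκ
  have hne : ∀ t : ℝ, P.eval (Complex.exp (t * Complex.I)) ≠ 0 := fun t =>
    eval_ne_zero_of_nearly_flat hdeg hs0 hε (by linarith) hY hlo hhi (by simp [hY0.le])
  have hB : ∀ t : ℝ, ‖P.eval (Complex.exp (t * Complex.I))‖ ≤ 3 / 2 * s := fun t =>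
    (h.2 t).2.trans (by gcongr; linarith)
  have h1 := norm_sum_coeff_mul_coeff_le hco hne hκ hB hq hqn
  have h2 := norm_sum_sq_mul_coeff_mul_coeff_le (n := n) hκ (by positivity) hB
  set S := ∑ k ∈ Finset.range (n + 1), P.coeff k * P.coeff (n - k)
  have hn1 : (1 : ℝ) ≤ n := by exact_mod_cast hn
  have hq1 : (1 : ℝ) ≤ q := by exact_mod_cast hq
  have hB2 : (3 / 2 * s) ^ 2 = 9 / 4 * (n + 1) := by rw [mul_pow, hs2]; norm_num
  rw [hB2] at h1 h2
  have hpi : Real.pi ^ 2 ≤ 10 := by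
    have := Real.pi_lt_d2
    nlinarith [Real.pi_pos]
  have h3 : 2 * (κ * n ^ 2) * (9 / 4 * (n + 1)) * (Real.pi * q ^ 2 / (n + 1)) ^ 2 ≤
      45 * κ * q ^ 4 * n := by
    have e : 2 * (κ * n ^ 2) * (9 / 4 * (n + 1)) * (Real.pi * q ^ 2 / (n + 1)) ^ 2 =
        9 / 2 * κ * q ^ 4 * n * (Real.pi ^ 2 * (n / (n + 1))) := by
      field_simp
      norm_num
    have hfrac : (n : ℝ) / (n + 1) ≤ 1 := by
      rw [div_le_one (by positivity)]; linarith
    rw [e]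
    calc 9 / 2 * κ * q ^ 4 * n * (Real.pi ^ 2 * (n / (n + 1)))
        ≤ 9 / 2 * κ * q ^ 4 * n * (10 * 1) := by gcongr
      _ = _ := by ring
  have h4 : ((n : ℝ) + 1) / q ≤ 2 * n / q := by gcongr; linarith
  have h5 : ‖S‖ ≤ 45 * κ * q ^ 4 * n + 2 * n / q := h1.trans (add_le_add h3 h4)
  have hq4 : (1 : ℝ) ≤ (q : ℝ) ^ 4 := one_le_pow₀ hq1
  calc _ ≤ _ := h2
    _ ≤ (κ * n ^ 2 * (9 / 4 * (n + n)) * q ^ 4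
          + n ^ 2 / 2 * (45 * κ * q ^ 4 * n + 2 * n / q)) / 2 := by
        have h6 : κ * n ^ 2 * (9 / 4 * ((n : ℝ) + 1)) ≤ κ * n ^ 2 * (9 / 4 * (n + n)) * q ^ 4 :=
          calc κ * n ^ 2 * (9 / 4 * ((n : ℝ) + 1)) ≤ κ * n ^ 2 * (9 / 4 * (n + n)) := by gcongr
            _ ≤ _ := le_mul_of_one_le_right (by positivity) hq4
        have h7 := mul_le_mul_of_nonneg_left h5 (show (0 : ℝ) ≤ n ^ 2 / 2 by positivity)
        linarith
    -- The constants 28 and 2 in the statement are rounded up from 13.5 and 1/2.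
    _ = (13.5 * κ * q ^ 4 + 1 / 2 / q) * n ^ 3 := by ring
    _ ≤ _ := by gcongr <;> norm_num

/-- The order of choices matters: q is fixed from η, then Y large in terms of q and η, and only then
j, so that ε is small in terms of Y and ν j ≥ q². -/
theorem IsUltraflat.tendsto_second_moment {ν : ℕ → ℕ} {P : ℕ → ℂ[X]} (hP : IsUltraflat ν P) :
    Filter.Tendsto (fun j => (∑ k ∈ Finset.range (ν j + 1),
      (k : ℂ) ^ 2 * ((P j).coeff k * (P j).coeff (ν j - k))) / (ν j : ℂ) ^ 3)
      Filter.atTop (nhds 0) := by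
  obtain ⟨hmono, hpos, ε, hε, hεt, hflat⟩ := hP
  rw [Metric.tendsto_nhds]
  intro η hη
  obtain ⟨q, hq⟩ := exists_nat_gt (8 / η)
  have hq0 : (0 : ℝ) < q := lt_trans (by positivity) hq
  have hY : Filter.Tendsto (fun Y : ℝ => 28 * (16 * (Y + 2) / Y ^ 2) * q ^ 4)
      Filter.atTop (nhds 0) := by
    have h1 : Filter.Tendsto (fun Y : ℝ => Y⁻¹) Filter.atTop (nhds 0) := tendsto_inv_atTop_zero
    have h2 : Filter.Tendsto
        (fun Y : ℝ => 28 * (16 * (Y⁻¹ + 2 * (Y⁻¹ * Y⁻¹))) * (q : ℝ) ^ 4) Filter.atTop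
        (nhds (28 * (16 * (0 + 2 * (0 * 0))) * (q : ℝ) ^ 4)) :=
      (((h1.add ((h1.mul h1).const_mul 2)).const_mul 16).const_mul 28).mul_const _
    simp only [mul_zero, add_zero, zero_mul] at h2
    refine h2.congr' ?_
    filter_upwards [Filter.eventually_gt_atTop 0] with Y hY
    field_simp
  obtain ⟨Y, hYη, hY0⟩ := ((hY.eventually_lt_const (half_pos hη)).and
    (Filter.eventually_gt_atTop 0)).exists
  have hε1 : ∀ᶠ j in Filter.atTop, ε j < min (1 / 2) (1 / (3 * Real.exp Y)) :=
    hεt.eventually_lt_const (by positivity)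
  filter_upwards [hε1, hmono.tendsto_atTop.eventually_ge_atTop (q ^ 2)] with j hj hjq
  have hj1 := hj.trans_le (min_le_left _ _)
  have hj2 := hj.trans_le (min_le_right _ _)
  rw [lt_div_iff₀ (by positivity)] at hj2
  have h := (hflat j).second_moment_le (hpos j) (hε j) hj1.le hY0
    (by linarith) (by exact_mod_cast hq0) (hjq.trans (Nat.le_succ _))
  have hn : (0 : ℝ) < ν j := by exact_mod_cast hpos j
  rw [dist_zero_right, norm_div, norm_pow, Complex.norm_natCast, div_lt_iff₀ (by positivity)]
  refine h.trans_lt ?_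
  have h2q : 2 / (q : ℝ) < η / 2 := by
    rw [div_lt_iff₀ hη] at hq
    rw [div_lt_iff₀ hq0]
    linarith
  gcongr
  linarith

/-! ### The integral identity and the limit -/

/-- Parseval for the Euler operator applied to P - P*; its factor z has modulus 1 on the circle. -/
theorem sum_sq_norm_coeff_sub_eq_integral {n : ℕ} {P : ℂ[X]} (hP : P.natDegree ≤ n) :
    ∑ k ∈ Finset.range (n + 1), (k : ℝ) ^ 2 * ‖P.coeff k - starRingEnd ℂ (P.coeff (n - k))‖ ^ 2 =
      1 / (2 * Real.pi) * ∫ t in (0 : ℝ)..(2 * Real.pi),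
        ‖(P.derivative - (conjReciprocal n P).derivative).eval
          (Complex.exp (t * Complex.I))‖ ^ 2 := by
  set R := P - conjReciprocal n P with hR
  have hdeg : R.natDegree ≤ n :=
    (natDegree_sub_le _ _).trans (max_le hP (natDegree_conjReciprocal_le n P))
  have h := sum_range_sq_norm_coeff_eq_integral R.euler
    (Nat.lt_succ_of_le (natDegree_euler_le R hdeg))
  have e1 : ∀ t : ℝ, ‖R.euler.eval (Complex.exp (t * Complex.I))‖ =
      ‖(P.derivative - (conjReciprocal n P).derivative).eval (Complex.exp (t * Complex.I))‖ := by
    intro t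
    rw [euler, eval_mul, eval_X, norm_mul, Complex.norm_exp_ofReal_mul_I, one_mul, hR,
      derivative_sub]
  simp only [e1] at h
  rw [← h]
  refine Finset.sum_congr rfl fun k hk => ?_
  have hk' : k ≤ n := by have := Finset.mem_range.1 hk; omega
  rw [coeff_euler, hR, coeff_sub, coeff_conjReciprocal n P hk', norm_mul, mul_pow,
    Complex.norm_natCast]

theorem sum_sq_norm_coeff_sub_eq {n : ℕ} {P : ℂ[X]} (hP : ∀ k ≤ n, ‖P.coeff k‖ = 1) :
    ∑ k ∈ Finset.range (n + 1), (k : ℝ) ^ 2 * ‖P.coeff k - starRingEnd ℂ (P.coeff (n - k))‖ ^ 2 =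
      n * (n + 1) * (2 * n + 1) / 3 - 2 *
        (∑ k ∈ Finset.range (n + 1), (k : ℂ) ^ 2 * (P.coeff k * P.coeff (n - k))).re := by
  have hsum : ∀ m : ℕ, ∑ k ∈ Finset.range (m + 1), 2 * (k : ℝ) ^ 2 =
      (m : ℝ) * (m + 1) * (2 * m + 1) / 3 := by
    intro m
    induction m with
    | zero => simp
    | succ m ih => rw [Finset.sum_range_succ, ih]; push_cast; ring
  rw [← hsum, Complex.re_sum, Finset.mul_sum, ← Finset.sum_sub_distrib]
  refine Finset.sum_congr rfl fun k hk => ?_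
  have hk' : k ≤ n := by have := Finset.mem_range.1 hk; omega
  have e1 : ‖P.coeff k - starRingEnd ℂ (P.coeff (n - k))‖ ^ 2 =
      2 - 2 * (P.coeff k * P.coeff (n - k)).re := by
    rw [Complex.sq_norm, Complex.normSq_sub, Complex.normSq_eq_norm_sq, Complex.normSq_eq_norm_sq,
      RCLike.norm_conj, hP k hk', hP _ (Nat.sub_le n k)]
    simp
    ring
  have e2 : ((k : ℂ) ^ 2 * (P.coeff k * P.coeff (n - k))).re =
      (k : ℝ) ^ 2 * (P.coeff k * P.coeff (n - k)).re := by
    have : (k : ℂ) ^ 2 = (((k : ℝ) ^ 2 : ℝ) : ℂ) := by push_cast; rfl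
    rw [this, Complex.re_ofReal_mul]
  rw [e1, e2]
  ring

theorem theorem2p3 (ν : ℕ → ℕ) (P : ℕ → Polynomial ℂ) (hP : IsUltraflat ν P) :
    (∀ j : ℕ,
      ∑ k ∈ Finset.range (ν j + 1),
          (k : ℝ) ^ 2 * ‖(P j).coeff k - starRingEnd ℂ ((P j).coeff (ν j - k))‖ ^ 2 =
        1 / (2 * Real.pi) * ∫ t in (0 : ℝ)..(2 * Real.pi),
          ‖((P j).derivative - (conjReciprocal (ν j) (P j)).derivative).eval
            (Complex.exp (t * Complex.I))‖ ^ 2) ∧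
    Filter.Tendsto
      (fun j : ℕ =>
        (1 / (2 * Real.pi) * ∫ t in (0 : ℝ)..(2 * Real.pi),
          ‖((P j).derivative - (conjReciprocal (ν j) (P j)).derivative).eval
            (Complex.exp (t * Complex.I))‖ ^ 2) /
        (2 * (ν j : ℝ) ^ 3 / 3))
      Filter.atTop (nhds 1) := by
  have hlim := hP.tendsto_second_moment
  obtain ⟨hmono, hpos, ε, -, -, hflat⟩ := hP
  have hmem : ∀ j, (P j).natDegree ≤ ν j ∧ ∀ k ≤ ν j, ‖(P j).coeff k‖ = 1 :=
    fun j => coeff_of_mem_unimodularClass (hflat j).1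
  have hint := fun j => sum_sq_norm_coeff_sub_eq_integral (hmem j).1
  refine ⟨hint, ?_⟩
  have hinv : Filter.Tendsto (fun j => (ν j : ℝ)⁻¹) Filter.atTop (nhds 0) :=
    tendsto_inv_atTop_zero.comp (tendsto_natCast_atTop_atTop.comp hmono.tendsto_atTop)
  have hre := (Complex.continuous_re.tendsto 0).comp hlim
  -- Dividing by 2n³/3 turns the main term into (1 + 1/n)(2 + 1/n)/2 and 2 Re T into 3 Re(T/n³).
  have hmain := ((((hinv.const_add 1).mul (hinv.const_add 2)).div_const 2).sub
    (hre.const_mul 3))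
  simp only [add_zero, Complex.zero_re, mul_zero, sub_zero, one_mul] at hmain
  rw [div_self two_ne_zero] at hmain
  refine hmain.congr fun j => ?_
  have hn : (ν j : ℝ) ≠ 0 := by exact_mod_cast (hpos j).ne'
  have e : ((ν j : ℂ)) ^ 3 = (((ν j : ℝ) ^ 3 : ℝ) : ℂ) := by push_cast; rfl
  rw [← hint j, sum_sq_norm_coeff_sub_eq (hmem j).2, Function.comp_apply, e, Complex.div_ofReal_re]
  field_simp
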